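/- Let $d\in\mathbb N$ and $a,b>0$. Let $\mathcal M(\mathbb R^d)$ be the set of positive Borel measures of finite mass on $\mathbb R^d$ and $\mathcal M^s(\mathbb R^d)$ the real vector space of finite signed Borel measures, i.e. of differences $\mu=\mu_+-\mu_-$ with $\mu_\pm\in\mathcal M(\mathbb R^d)$. For a signed measure $\sigma$ with Jordan decomposition $\sigma=\sigma_+^J-\sigma_-^J$ put $|\sigma|=\sigma_+^J(\mathbb R^d)+\sigma_-^J(\mathbb R^d)$. For $\mu,\nu\in\mathcal M(\mathbb R^d)$ with $|\mu|=|\nu|$ let $W_1(\mu,\nu)=\inf_\pi\int_{\mathbb R^d\times\mathbb R^d}|x-y|\,d\pi(x,y)\in[0,\infty]$, the infimum being over all measures $\pi$ on $\mathbb R^d\times\mathbb R^d$ with first marginal $\mu$ and second marginal $\nu$; and for arbitrary $\mu,\nu\in\mathcal M(\mathbb R^d)$ let $$W_1^{a,b}(\mu,\nu)=\inf\left\{a\big(|\mu-\tilde\mu|+|\nu-\tilde\nu|\big)+b\,W_1(\tilde\mu,\tilde\nu)\;:\;\tilde\mu,\tilde\nu\in\mathcal M(\mathbb R^d),\ |\tilde\mu|=|\tilde\nu|\right\}.$$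 For $\mu\in\mathcal M^s(\mathbb R^d)$ define $\|\mu\|^{a,b}=W_1^{a,b}(\mu_+,\mu_-)$, where $\mu_+,\mu_-\in\mathcal M(\mathbb R^d)$ are any measures with $\mu=\mu_+-\mu_-$. Then $\|\mu\|^{a,b}$ is well defined (it is finite and does not depend on the choice of $\mu_+,\mu_-$), and $(\mathcal M^s(\mathbb R^d),\|\cdot\|^{a,b})$ is a normed vector space: for all $\mu,\eta\in\mathcal M^s(\mathbb R^d)$ and $\lambda\in\mathbb R$, $\|\mu\|^{a,b}\ge 0$, with equality if and only if $\mu=0$; $\|\mu+\eta\|^{a,b}\le\|\mu\|^{a,b}+\|\eta\|^{a,b}$; and $\|\lambda\mu\|^{a,b}=|\lambda|\,\|\mu\|^{a,b}$. -/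

import Mathlib

open MeasureTheory
open scoped ENNReal

noncomputable section

namespace GenWasserstein

/-- `ℝ^d` with its Euclidean norm and its Borel σ-algebra. -/
abbrev Space (d : ℕ) : Type := EuclideanSpace ℝ (Fin d)

/-- `𝓜(ℝ^d)`: positive Borel measures of finite mass (on `ℝ^d` these are automatically Radon). -/
abbrev PosMeas (d : ℕ) : Type := FiniteMeasure (Space d)

/-- `𝓜^s(ℝ^d)`: finite signed Borel measures on `ℝ^d`, i.e. differences of two elements of
`𝓜(ℝ^d)`, with the usual vector space structure. -/
abbrev SgnMeas (d : ℕ) : Type := SignedMeasure (Space d)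

/-- The difference `μ - ν` of two positive finite measures, as a signed measure. -/
def diff {d : ℕ} (μ ν : PosMeas d) : SgnMeas d :=
  (μ : Measure (Space d)).toSignedMeasure - (ν : Measure (Space d)).toSignedMeasure

/-- The mass `|σ| = |σ₊| + |σ₋|` of a signed measure with Jordan decomposition `(σ₊, σ₋)`. -/
def mass {d : ℕ} (σ : SgnMeas d) : ℝ≥0∞ :=
  σ.toJordanDecomposition.posPart Set.univ + σ.toJordanDecomposition.negPart Set.univ

/-- `π` is a transference plan from `μ` to `ν`: its marginals are `μ` and `ν`. -/
def IsPlan {d : ℕ} (π : Measure (Space d × Space d)) (μ ν : PosMeas d) : Prop :=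
  π.fst = (μ : Measure (Space d)) ∧ π.snd = (ν : Measure (Space d))

/-- The Wasserstein distance `W₁(μ, ν) = inf_π ∫ |x - y| dπ(x, y)` between measures of the same
mass, with values in `[0, ∞]`. -/
def W₁ {d : ℕ} (μ ν : PosMeas d) : ℝ≥0∞ :=
  ⨅ (π : Measure (Space d × Space d)) (_ : IsPlan π μ ν),
    ∫⁻ z, ENNReal.ofReal ‖z.1 - z.2‖ ∂π

/-- The generalized Wasserstein distance
`W₁^{a,b}(μ, ν) = inf a (|μ - μ'| + |ν - ν'|) + b W₁(μ', ν')` over all positive finite measures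
`μ'`, `ν'` of the same mass. -/
def genW₁ {d : ℕ} (a b : ℝ) (μ ν : PosMeas d) : ℝ≥0∞ :=
  ⨅ (μ' : PosMeas d) (ν' : PosMeas d) (_ : μ'.mass = ν'.mass),
    ENNReal.ofReal a * (mass (diff μ μ') + mass (diff ν ν')) + ENNReal.ofReal b * W₁ μ' ν'

/-- The positive part of the Jordan decomposition. -/
def posPart {d : ℕ} (μ : SgnMeas d) : PosMeas d := ⟨μ.toJordanDecomposition.posPart, inferInstance⟩

/-- The negative part of the Jordan decomposition. -/
def negPart {d : ℕ} (μ : SgnMeas d) : PosMeas d := ⟨μ.toJordanDecomposition.negPart, inferInstance⟩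

/-- `‖μ‖^{a,b} = W₁^{a,b}(μ₊, μ₋)`, computed from the Jordan decomposition of `μ`. -/
def sgnNorm {d : ℕ} (a b : ℝ) (μ : SgnMeas d) : ℝ :=
  (genW₁ a b (posPart μ) (negPart μ)).toReal

end GenWasserstein

end

/-! `genW₁ a b p m` is the infimum of the costs of generalized plans (`genW₁_le_cost`,
`exists_cost_lt`): a transport plan plus four measures recording how its marginals miss `p` and `m`.
Plans can be added, scaled, reversed and composed, so `genW₁` is finite, subadditive, homogeneous,
symmetric and satisfies the triangle inequality.

Independence of the decomposition reduces to cancellation, `genW₁_add_right`. Replacing `n` copies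
of `p` by `n` copies of `m`, one at a time in the presence of a single `r`, costs at most `n` times
the distance from `p + r` to `m + r`; adding and removing `r` costs a constant. Homogeneity and
division by `n` give the claim.

Definiteness holds because a plan of small cost forces bounded Lipschitz functions to have nearly
equal integrals (`GenPlan.lintegral_le`). -/

open scoped NNReal ProbabilityTheory

noncomputable section

namespace GenWasserstein

variable {d : ℕ}

/-! ### Transport plans and gluing. -/

section Gluing

/-- The transport cost `∫ |x - y| dπ(x, y)` of a plan. -/
def transportCost (π : Measure (Space d × Space d)) : ℝ≥0∞ :=
  ∫⁻ z, ENNReal.ofReal ‖z.1 - z.2‖ ∂π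

lemma measurable_cost :
    Measurable fun z : Space d × Space d => ENNReal.ofReal ‖z.1 - z.2‖ := by
  fun_prop

lemma transportCost_add (π ρ : Measure (Space d × Space d)) :
    transportCost (π + ρ) = transportCost π + transportCost ρ :=
  lintegral_add_measure _ _ _

lemma transportCost_swap (π : Measure (Space d × Space d)) :
    transportCost (π.map Prod.swap) = transportCost π := by
  unfold transportCost
  rw [lintegral_map measurable_cost measurable_swap]
  simp [norm_sub_rev]

/-- The plan that leaves all the mass of `α` in place. -/
def diagonalPlan (α : Measure (Space d)) : Measure (Space d × Space d) :=
  α.map fun x => (x, x)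

instance (α : Measure (Space d)) [IsFiniteMeasure α] : IsFiniteMeasure (diagonalPlan α) := by
  unfold diagonalPlan; infer_instance

@[simp] lemma fst_diagonalPlan (α : Measure (Space d)) : (diagonalPlan α).fst = α := by
  unfold diagonalPlan
  rw [Measure.fst_map_prodMk (by fun_prop)]
  exact Measure.map_id

@[simp] lemma snd_diagonalPlan (α : Measure (Space d)) : (diagonalPlan α).snd = α := by
  unfold diagonalPlan
  rw [Measure.snd_map_prodMk (by fun_prop)]
  exact Measure.map_id

@[simp] lemma transportCost_diagonalPlan (α : Measure (Space d)) :
    transportCost (diagonalPlan α) = 0 := by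
  unfold transportCost diagonalPlan
  rw [lintegral_map measurable_cost (by fun_prop)]
  simp

/-- Gluing of two transport plans along a common marginal. -/
lemma exists_glued_plan (π ρ : Measure (Space d × Space d)) [IsFiniteMeasure π]
    [IsFiniteMeasure ρ] (h : π.snd = ρ.fst) :
    ∃ τ : Measure (Space d × Space d), IsFiniteMeasure τ ∧ τ.fst = π.fst ∧ τ.snd = ρ.snd ∧
      transportCost τ ≤ transportCost π + transportCost ρ := by
  set σ := π.map Prod.swap with hσ
  have hfst : σ.fst = ρ.fst := by rw [hσ, Measure.fst_map_swap, h]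
  have eσ : ρ.fst ⊗ₘ σ.condKernel = σ := by rw [← hfst]; exact σ.disintegrate _
  have eρ : ρ.fst ⊗ₘ ρ.condKernel = ρ := ρ.disintegrate _
  -- Coordinates are `(y, (x, z))`: given the common point `y`, the source `x` and the target `z`
  -- are drawn independently.
  let θ := ρ.fst ⊗ₘ (σ.condKernel ×ₖ ρ.condKernel)
  have hθ₁ : θ.map (fun z => (z.1, z.2.1)) = σ := by
    have := Measure.compProd_map (μ := ρ.fst) (κ := σ.condKernel ×ₖ ρ.condKernel)
      (f := Prod.fst) measurable_fst
    rw [← ProbabilityTheory.Kernel.fst_eq, ProbabilityTheory.Kernel.fst_prod, eσ] at this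
    exact this.symm
  have hθ₂ : θ.map (fun z => (z.1, z.2.2)) = ρ := by
    have := Measure.compProd_map (μ := ρ.fst) (κ := σ.condKernel ×ₖ ρ.condKernel)
      (f := Prod.snd) measurable_snd
    rw [← ProbabilityTheory.Kernel.snd_eq, ProbabilityTheory.Kernel.snd_prod, eρ] at this
    exact this.symm
  have hπ : θ.map (fun z => (z.2.1, z.1)) = π := by
    have : π = σ.map Prod.swap := by
      rw [hσ, Measure.map_map measurable_swap measurable_swap]; simp
    rw [this, ← hθ₁, Measure.map_map measurable_swap (by fun_prop)]
    rfl
  refine ⟨θ.map (fun z => (z.2.1, z.2.2)), inferInstance, ?_, ?_, ?_⟩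
  · rw [Measure.fst_map_prodMk (by fun_prop), ← hπ, Measure.fst_map_prodMk (by fun_prop)]
  · rw [Measure.snd_map_prodMk (by fun_prop)]
    conv_rhs => rw [← hθ₂, Measure.snd_map_prodMk (by fun_prop)]
  · have e₁ : transportCost π = ∫⁻ z, ENNReal.ofReal ‖z.2.1 - z.1‖ ∂θ := by
      rw [← hπ, transportCost, lintegral_map measurable_cost (by fun_prop)]
    have e₂ : transportCost ρ = ∫⁻ z, ENNReal.ofReal ‖z.1 - z.2.2‖ ∂θ := by
      rw [transportCost]
      conv_lhs => rw [← hθ₂]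
      rw [lintegral_map measurable_cost (by fun_prop)]
    rw [e₁, e₂, transportCost, lintegral_map measurable_cost (by fun_prop),
      ← lintegral_add_left (by fun_prop)]
    refine lintegral_mono fun z => ?_
    rw [← ENNReal.ofReal_add (norm_nonneg _) (norm_nonneg _)]
    exact ENNReal.ofReal_le_ofReal (norm_sub_le_norm_sub_add_norm_sub _ _ _)

end Gluing

/-! ### Jordan decompositions and mass. -/

section Mass

/-- The mass of a difference is at most the mass of any pair of measures that compensates it. -/
lemma mass_diff_le (μ ν : PosMeas d) (γ δ : Measure (Space d)) [IsFiniteMeasure γ]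
    [IsFiniteMeasure δ] (h : (μ : Measure (Space d)) + γ = ν + δ) :
    mass (diff μ ν) ≤ γ Set.univ + δ Set.univ := by
  -- The variation is the least measure dominating `|σ(E)|` on every measurable `E`, and here `σ = δ
  -- - γ`.
  have key : (diff μ ν).variation ≤ γ + δ := by
    refine VectorMeasure.variation_le_of_forall_enorm_le fun E hE => ?_
    have hE' := congrArg (fun τ : Measure (Space d) => τ.real E) h
    rw [measureReal_add_apply, measureReal_add_apply] at hE'
    have : diff μ ν E = δ.real E - γ.real E := by
      rw [diff, Measure.toSignedMeasure_sub_apply hE]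
      linarith
    rw [this, Measure.add_apply, add_comm]
    refine (enorm_sub_le).trans ?_
    simp [Real.enorm_of_nonneg, measureReal_nonneg, ofReal_measureReal]
  calc mass (diff μ ν) = (diff μ ν).totalVariation Set.univ := rfl
    _ = (diff μ ν).variation Set.univ := by rw [SignedMeasure.totalVariation_eq_variation]
    _ ≤ _ := key _

lemma diff_posPart_negPart (σ : SgnMeas d) : diff (posPart σ) (negPart σ) = σ :=
  σ.toSignedMeasure_toJordanDecomposition

lemma diff_eq_diff_iff (p m p' m' : PosMeas d) : diff p m = diff p' m' ↔ p + m' = p' + m := by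
  rw [diff, diff, sub_eq_sub_iff_add_eq_add, ← Measure.toSignedMeasure_add,
    ← Measure.toSignedMeasure_add, Measure.toSignedMeasure_eq_toSignedMeasure_iff,
    ← FiniteMeasure.toMeasure_add, ← FiniteMeasure.toMeasure_add]
  exact Subtype.coe_injective.eq_iff

lemma add_negPart_diff (μ ν : PosMeas d) :
    (μ : Measure (Space d)) + negPart (diff μ ν) = ν + posPart (diff μ ν) := by
  have := (diff_eq_diff_iff _ _ _ _).1 (diff_posPart_negPart (diff μ ν))
  rw [add_comm, eq_comm] at this
  exact congrArg (fun τ : PosMeas d => (τ : Measure (Space d))) this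

end Mass

/-! ### Calculus of generalized plans. -/

/-- A transport plan `plan` together with measures that compensate the defect between its
marginals and `p`, `m`. -/
structure GenPlan (p m : Measure (Space d)) where
  /-- the transport plan -/
  plan : Measure (Space d × Space d)
  /-- mass missing from `p` -/
  lack : Measure (Space d)
  /-- mass of `p` in excess -/
  excess : Measure (Space d)
  /-- mass missing from `m` -/
  lack' : Measure (Space d)
  /-- mass of `m` in excess -/
  excess' : Measure (Space d)
  [finite_plan : IsFiniteMeasure plan]
  [finite_lack : IsFiniteMeasure lack]
  [finite_excess : IsFiniteMeasure excess]
  [finite_lack' : IsFiniteMeasure lack']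
  [finite_excess' : IsFiniteMeasure excess']
  balance : p + lack = plan.fst + excess
  balance' : m + lack' = plan.snd + excess'

namespace GenPlan

attribute [instance] finite_plan finite_lack finite_excess finite_lack' finite_excess'

variable {p m q p' m' : Measure (Space d)}

/-- The cost of a generalized plan. -/
def cost (P : GenPlan p m) (a b : ℝ) : ℝ≥0∞ :=
  ENNReal.ofReal a * (P.lack Set.univ + P.excess Set.univ +
    (P.lack' Set.univ + P.excess' Set.univ)) + ENNReal.ofReal b * transportCost P.plan

/-- The plan that creates `m` and destroys `p`. -/
def trivial (p m : Measure (Space d)) [IsFiniteMeasure p] [IsFiniteMeasure m] : GenPlan p m where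
  plan := 0
  lack := 0
  excess := p
  lack' := 0
  excess' := m
  balance := by simp [Measure.fst]
  balance' := by simp [Measure.snd]

lemma cost_trivial (p m : Measure (Space d)) [IsFiniteMeasure p] [IsFiniteMeasure m] (a b : ℝ) :
    (trivial p m).cost a b = ENNReal.ofReal a * (p Set.univ + m Set.univ) := by
  simp [cost, trivial, transportCost]

/-- The plan that leaves `r` in place. -/
def refl (r : Measure (Space d)) [IsFiniteMeasure r] : GenPlan r r where
  plan := diagonalPlan r
  lack := 0
  excess := 0
  lack' := 0
  excess' := 0
  balance := by simp
  balance' := by simp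

lemma cost_refl (r : Measure (Space d)) [IsFiniteMeasure r] (a b : ℝ) :
    (refl r).cost a b = 0 := by
  simp [cost, refl]

/-- The sum of two generalized plans. -/
def add (P : GenPlan p m) (Q : GenPlan p' m') : GenPlan (p + p') (m + m') where
  plan := P.plan + Q.plan
  lack := P.lack + Q.lack
  excess := P.excess + Q.excess
  lack' := P.lack' + Q.lack'
  excess' := P.excess' + Q.excess'
  balance := by
    rw [Measure.fst_add, add_add_add_comm, P.balance, Q.balance, add_add_add_comm]
  balance' := by
    rw [Measure.snd_add, add_add_add_comm, P.balance', Q.balance', add_add_add_comm]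

lemma cost_add (P : GenPlan p m) (Q : GenPlan p' m') (a b : ℝ) :
    (P.add Q).cost a b = P.cost a b + Q.cost a b := by
  simp only [cost, add, transportCost_add, Measure.add_apply]
  ring

/-- A generalized plan multiplied by a scalar. -/
def smul (c : ℝ≥0) (P : GenPlan p m) : GenPlan (c • p) (c • m) where
  plan := c • P.plan
  lack := c • P.lack
  excess := c • P.excess
  lack' := c • P.lack'
  excess' := c • P.excess'
  balance := by
    rw [← smul_add, P.balance, smul_add, Measure.fst, Measure.fst, Measure.map_smul]
  balance' := by
    rw [← smul_add, P.balance', smul_add, Measure.snd, Measure.snd, Measure.map_smul]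

lemma cost_smul (c : ℝ≥0) (P : GenPlan p m) (a b : ℝ) :
    (P.smul c).cost a b = c * P.cost a b := by
  simp only [cost, smul, transportCost, lintegral_smul_measure, Measure.smul_apply,
    ENNReal.smul_def, smul_eq_mul]
  ring

/-- The reversed generalized plan. -/
def symm (P : GenPlan p m) : GenPlan m p where
  plan := P.plan.map Prod.swap
  lack := P.lack'
  excess := P.excess'
  lack' := P.lack
  excess' := P.excess
  balance := by rw [Measure.fst_map_swap, P.balance']
  balance' := by rw [Measure.snd_map_swap, P.balance]

lemma cost_symm (P : GenPlan p m) (a b : ℝ) : P.symm.cost a b = P.cost a b := by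
  simp only [cost, symm, transportCost_swap]
  ring

lemma exists_trans (P : GenPlan p m) (Q : GenPlan m q) (a b : ℝ) :
    ∃ R : GenPlan p q, R.cost a b ≤ P.cost a b + Q.cost a b := by
  -- The two plans need not share a marginal near `m`. Leaving `α` and `β` in place makes the inner
  -- marginals agree at no transport cost; in the glued plan they become extra lack at the two ends,
  -- so the total defect is unchanged.
  let α := P.excess' + Q.lack
  let β := Q.excess + P.lack'
  obtain ⟨τ, hτ, hfst, hsnd, hcost⟩ := exists_glued_plan (P.plan + diagonalPlan α)
    (Q.plan + diagonalPlan β) (by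
      rw [Measure.snd_add, Measure.fst_add, snd_diagonalPlan, fst_diagonalPlan, ← add_assoc,
        ← P.balance', ← add_assoc, ← Q.balance]
      abel)
  rw [Measure.fst_add, fst_diagonalPlan] at hfst
  rw [Measure.snd_add, snd_diagonalPlan] at hsnd
  refine ⟨⟨τ, P.lack + α, P.excess, Q.lack' + β, Q.excess', ?_, ?_⟩, ?_⟩
  · rw [← add_assoc, P.balance, hfst]; abel
  · rw [← add_assoc, Q.balance', hsnd]; abel
  · have h : transportCost τ ≤ transportCost P.plan + transportCost Q.plan := by
      simpa [transportCost_add] using hcost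
    calc _ ≤ ENNReal.ofReal a * ((P.lack + α) Set.univ + P.excess Set.univ +
          ((Q.lack' + β) Set.univ + Q.excess' Set.univ)) +
          ENNReal.ofReal b * (transportCost P.plan + transportCost Q.plan) := by
          unfold cost; gcongr
      _ = _ := by simp only [cost, α, β, Measure.add_apply]; ring

/-- Bounded Lipschitz functions have comparable integrals with respect to `p` and `m`. -/
lemma lintegral_le (P : GenPlan p m) {a b : ℝ} (ha : 0 < a) (hb : 0 < b) {K : ℝ≥0}
    {f : Space d → ℝ≥0} (hf : LipschitzWith K f) (hf1 : ∀ x, f x ≤ 1) :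
    ∫⁻ x, f x ∂p ≤ ∫⁻ x, f x ∂m +
      ((ENNReal.ofReal a)⁻¹ + K * (ENNReal.ofReal b)⁻¹) * P.cost a b := by
  have hm : Measurable fun x => (f x : ℝ≥0∞) := by
    have := hf.continuous.measurable
    fun_prop
  have hbd (ν : Measure (Space d)) : ∫⁻ x, f x ∂ν ≤ ν Set.univ := by
    rw [← lintegral_one]
    exact lintegral_mono fun x => by simpa using hf1 x
  have h₁ : ∫⁻ x, f x ∂p ≤ ∫⁻ x, f x ∂P.plan.fst + P.excess Set.univ := by
    calc ∫⁻ x, f x ∂p ≤ ∫⁻ x, f x ∂(p + P.lack) := by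
          rw [lintegral_add_measure]; exact le_self_add
      _ ≤ _ := by rw [P.balance, lintegral_add_measure]; gcongr; exact hbd _
  have h₂ : ∫⁻ x, f x ∂P.plan.snd ≤ ∫⁻ x, f x ∂m + P.lack' Set.univ := by
    calc ∫⁻ x, f x ∂P.plan.snd ≤ ∫⁻ x, f x ∂(P.plan.snd + P.excess') := by
          rw [lintegral_add_measure]; exact le_self_add
      _ ≤ _ := by rw [← P.balance', lintegral_add_measure]; gcongr; exact hbd _
  have h₃ : ∫⁻ x, f x ∂P.plan.fst ≤ ∫⁻ x, f x ∂P.plan.snd + K * transportCost P.plan := by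
    rw [Measure.fst, Measure.snd, lintegral_map hm measurable_fst, lintegral_map hm measurable_snd,
      transportCost, ← lintegral_const_mul _ measurable_cost,
      ← lintegral_add_left (f := fun z : Space d × Space d => (f z.2 : ℝ≥0∞))
        (hm.comp measurable_snd)]
    refine lintegral_mono fun z => ?_
    have h := hf z.1 z.2
    rw [edist_dist z.1, dist_eq_norm] at h
    refine le_trans ?_ (add_le_add le_rfl h)
    have h' : f z.1 ≤ f z.2 + nndist (f z.1) (f z.2) := by
      rw [← NNReal.coe_le_coe]
      push_cast
      rw [NNReal.dist_eq]
      linarith [le_abs_self ((f z.1 : ℝ) - f z.2)]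
    rw [edist_nndist, ← ENNReal.coe_add]
    exact ENNReal.coe_le_coe.2 h'
  have ha' : ENNReal.ofReal a ≠ 0 := by simpa using ha
  have hb' : ENNReal.ofReal b ≠ 0 := by simpa using hb
  -- Only these two of the four defects can make the integral against `p` exceed the one against
  -- `m`.
  have h₄ : P.excess Set.univ + P.lack' Set.univ ≤ (ENNReal.ofReal a)⁻¹ * P.cost a b := by
    rw [← ENNReal.div_eq_inv_mul, ENNReal.le_div_iff_mul_le (.inl ha') (.inl ENNReal.ofReal_ne_top),
      mul_comm]
    refine le_trans ?_ le_self_add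
    gcongr
    · exact le_add_self
    · exact le_self_add
  have h₅ : transportCost P.plan ≤ (ENNReal.ofReal b)⁻¹ * P.cost a b := by
    rw [← ENNReal.div_eq_inv_mul, ENNReal.le_div_iff_mul_le (.inl hb') (.inl ENNReal.ofReal_ne_top),
      mul_comm]
    exact le_add_self
  calc ∫⁻ x, f x ∂p
      ≤ ∫⁻ x, f x ∂m + P.lack' Set.univ + K * transportCost P.plan + P.excess Set.univ := by
        refine h₁.trans ?_
        gcongr
        refine h₃.trans ?_
        gcongr
    _ = ∫⁻ x, f x ∂m + ((P.excess Set.univ + P.lack' Set.univ) + K * transportCost P.plan) := by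
        ring
    _ ≤ ∫⁻ x, f x ∂m + ((ENNReal.ofReal a)⁻¹ * P.cost a b +
          K * ((ENNReal.ofReal b)⁻¹ * P.cost a b)) := by gcongr
    _ = _ := by ring

end GenPlan

/-! ### `genW₁` as an infimum over generalized plans. -/

section GenW₁

variable (a b : ℝ)

/-- The marginals of the plan serve as the intermediate measures; the defects need not be mutually
singular, so they only bound the Jordan masses from above. -/
lemma genW₁_le_cost {p m : PosMeas d} (P : GenPlan (p : Measure (Space d)) m) :
    genW₁ a b p m ≤ P.cost a b := by
  let μ : PosMeas d := ⟨P.plan.fst, inferInstance⟩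
  let ν : PosMeas d := ⟨P.plan.snd, inferInstance⟩
  have hmass : μ.mass = ν.mass := by
    change (P.plan.fst Set.univ).toNNReal = (P.plan.snd Set.univ).toNNReal
    rw [Measure.fst_univ, Measure.snd_univ]
  refine iInf_le_of_le μ (iInf_le_of_le ν (iInf_le_of_le hmass ?_))
  unfold GenPlan.cost
  gcongr
  · exact mass_diff_le _ _ _ _ P.balance
  · exact mass_diff_le _ _ _ _ P.balance'
  · exact iInf₂_le P.plan ⟨rfl, rfl⟩

lemma exists_cost_lt {p m : PosMeas d} (hb : 0 < b) {c : ℝ≥0∞} (h : genW₁ a b p m < c) :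
    ∃ P : GenPlan (p : Measure (Space d)) m, P.cost a b < c := by
  simp only [genW₁, W₁, iInf_lt_iff] at h
  obtain ⟨μ, ν, -, h⟩ := h
  -- Positivity of `b` matters: an infimum over no plan is `∞`, and must remain `∞` after
  -- multiplication by `b`.
  rw [ENNReal.mul_iInf_of_ne (by simpa using hb) ENNReal.ofReal_ne_top, ENNReal.add_iInf,
    iInf_lt_iff] at h
  obtain ⟨π, h⟩ := h
  rw [ENNReal.mul_iInf_of_ne (by simpa using hb) ENNReal.ofReal_ne_top] at h
  by_cases hπ : IsPlan π μ ν
  · have : IsFiniteMeasure π := ⟨by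
      rw [← Measure.fst_univ, hπ.1]; exact measure_lt_top _ _⟩
    -- With the Jordan parts as defects, the cost is exactly the quantity being minimized.
    refine ⟨⟨π, negPart (diff p μ), posPart (diff p μ), negPart (diff m ν), posPart (diff m ν),
      ?_, ?_⟩, ?_⟩
    · rw [hπ.1, add_negPart_diff]
    · rw [hπ.2, add_negPart_diff]
    · simp only [hπ, iInf_pos] at h
      rw [mass, mass, add_comm (_ : ℝ≥0∞) ((diff p μ).toJordanDecomposition.negPart _),
        add_comm (_ : ℝ≥0∞) ((diff m ν).toJordanDecomposition.negPart _)] at h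
      exact h
  · simp [hπ] at h

variable {a b}

lemma le_of_forall_cost (hb : 0 < b) {p m : PosMeas d} {c : ℝ≥0∞}
    (h : ∀ P : GenPlan (p : Measure (Space d)) m, c ≤ P.cost a b) : c ≤ genW₁ a b p m := by
  by_contra! hc
  obtain ⟨P, hP⟩ := exists_cost_lt a b hb hc
  exact absurd (h P) (not_le.2 hP)

/-! ### Finiteness, subadditivity, triangle inequality, symmetry, homogeneity. -/

lemma genW₁_le_mass (p m : PosMeas d) :
    genW₁ a b p m ≤ ENNReal.ofReal a *
      ((p : Measure (Space d)) Set.univ + (m : Measure (Space d)) Set.univ) :=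
  (genW₁_le_cost a b (.trivial _ _)).trans_eq (GenPlan.cost_trivial _ _ _ _)

lemma genW₁_ne_top (p m : PosMeas d) : genW₁ a b p m ≠ ∞ :=
  ne_top_of_le_ne_top (by finiteness) (genW₁_le_mass p m)

@[simp] lemma genW₁_self (p : PosMeas d) : genW₁ a b p p = 0 :=
  le_antisymm ((genW₁_le_cost a b (.refl _)).trans_eq (GenPlan.cost_refl _ _ _)) zero_le

lemma genW₁_add_le (hb : 0 < b) (p m p' m' : PosMeas d) :
    genW₁ a b (p + p') (m + m') ≤ genW₁ a b p m + genW₁ a b p' m' := by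
  refine ENNReal.le_of_forall_pos_le_add fun ε hε _ => ?_
  have hε' : (ε / 2 : ℝ≥0∞) ≠ 0 := by simpa using hε.ne'
  obtain ⟨P, hP⟩ := exists_cost_lt a b hb (ENNReal.lt_add_right (genW₁_ne_top p m) hε')
  obtain ⟨Q, hQ⟩ := exists_cost_lt a b hb (ENNReal.lt_add_right (genW₁_ne_top p' m') hε')
  let R : GenPlan ((p + p' : PosMeas d) : Measure (Space d)) (m + m' : PosMeas d) := P.add Q
  calc genW₁ a b (p + p') (m + m') ≤ R.cost a b := genW₁_le_cost a b R
    _ = P.cost a b + Q.cost a b := P.cost_add Q a b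
    _ ≤ (genW₁ a b p m + ε / 2) + (genW₁ a b p' m' + ε / 2) := add_le_add hP.le hQ.le
    _ = _ := by rw [add_add_add_comm, ENNReal.add_halves]

lemma genW₁_triangle (hb : 0 < b) (p m q : PosMeas d) :
    genW₁ a b p q ≤ genW₁ a b p m + genW₁ a b m q := by
  refine ENNReal.le_of_forall_pos_le_add fun ε hε _ => ?_
  have hε' : (ε / 2 : ℝ≥0∞) ≠ 0 := by simpa using hε.ne'
  obtain ⟨P, hP⟩ := exists_cost_lt a b hb (ENNReal.lt_add_right (genW₁_ne_top p m) hε')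
  obtain ⟨Q, hQ⟩ := exists_cost_lt a b hb (ENNReal.lt_add_right (genW₁_ne_top m q) hε')
  obtain ⟨R, hR⟩ := P.exists_trans Q a b
  calc genW₁ a b p q ≤ R.cost a b := genW₁_le_cost a b R
    _ ≤ P.cost a b + Q.cost a b := hR
    _ ≤ (genW₁ a b p m + ε / 2) + (genW₁ a b m q + ε / 2) := add_le_add hP.le hQ.le
    _ = _ := by rw [add_add_add_comm, ENNReal.add_halves]

lemma genW₁_comm (hb : 0 < b) (p m : PosMeas d) : genW₁ a b p m = genW₁ a b m p :=
  le_antisymm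
    (le_of_forall_cost hb fun P => (genW₁_le_cost a b P.symm).trans_eq (P.cost_symm a b))
    (le_of_forall_cost hb fun P => (genW₁_le_cost a b P.symm).trans_eq (P.cost_symm a b))

lemma genW₁_smul_le (hb : 0 < b) (c : ℝ≥0) (p m : PosMeas d) :
    genW₁ a b (c • p) (c • m) ≤ c * genW₁ a b p m := by
  rcases eq_or_ne c 0 with rfl | hc
  · simp
  rw [mul_comm, ← ENNReal.div_le_iff (by simpa using hc) (by simp)]
  refine le_of_forall_cost hb fun P => ?_
  rw [ENNReal.div_le_iff (by simpa using hc) (by simp), mul_comm, ← P.cost_smul]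
  let R : GenPlan ((c • p : PosMeas d) : Measure (Space d)) (c • m : PosMeas d) := P.smul c
  exact genW₁_le_cost a b R

lemma genW₁_smul (hb : 0 < b) (c : ℝ≥0) (p m : PosMeas d) :
    genW₁ a b (c • p) (c • m) = c * genW₁ a b p m := by
  refine le_antisymm (genW₁_smul_le hb c p m) ?_
  rcases eq_or_ne c 0 with rfl | hc
  · simp
  have h := genW₁_smul_le (a := a) hb c⁻¹ (c • p) (c • m)
  rw [inv_smul_smul₀ hc, inv_smul_smul₀ hc, ENNReal.coe_inv hc, ← ENNReal.div_eq_inv_mul,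
    ENNReal.le_div_iff_mul_le (by simp [hc]) (by simp), mul_comm] at h
  exact h

/-! ### Cancellation of a common summand. -/

lemma genW₁_add_right_le (hb : 0 < b) (p m r : PosMeas d) :
    genW₁ a b (p + r) (m + r) ≤ genW₁ a b p m := by
  simpa using genW₁_add_le (a := a) hb p m r r

/-- A single `r` acts as a catalyst: each copy of `p` is exchanged for one of `m` using the same
`r`, while the other copies are spectators. -/
lemma genW₁_nsmul_add_le (hb : 0 < b) (p m r : PosMeas d) (n : ℕ) :
    genW₁ a b (n • p + r) (n • m + r) ≤ n * genW₁ a b (p + r) (m + r) := by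
  induction n with
  | zero => simp
  | succ n ih =>
    calc genW₁ a b ((n + 1) • p + r) ((n + 1) • m + r)
        ≤ genW₁ a b ((n + 1) • p + r) ((n • m + r) + p) +
          genW₁ a b ((n • m + r) + p) ((n + 1) • m + r) := genW₁_triangle hb _ _ _
      _ = genW₁ a b ((n • p + r) + p) ((n • m + r) + p) +
          genW₁ a b ((p + r) + n • m) ((m + r) + n • m) := by
          congr 2
          · rw [succ_nsmul]; abel
          · abel
          · rw [succ_nsmul]; abel
      _ ≤ n * genW₁ a b (p + r) (m + r) + genW₁ a b (p + r) (m + r) :=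
          add_le_add ((genW₁_add_right_le hb _ _ _).trans ih) (genW₁_add_right_le hb _ _ _)
      _ = _ := by push_cast; ring

/-- Adding the same measure to both arguments does not change the distance. -/
lemma genW₁_add_right (hb : 0 < b) (p m r : PosMeas d) :
    genW₁ a b (p + r) (m + r) = genW₁ a b p m := by
  refine le_antisymm (genW₁_add_right_le hb p m r) ?_
  set D := genW₁ a b (p + r) (m + r)
  set C := genW₁ a b 0 r
  have hC : C ≠ ∞ := genW₁_ne_top _ _
  have hD : D ≠ ∞ := genW₁_ne_top _ _
  have hW : genW₁ a b p m ≠ ∞ := genW₁_ne_top _ _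
  -- The overhead `2 * C` pays for inserting and removing `r` once; it does not depend on `n`, so it
  -- vanishes after division by `n`.
  have key (n : ℕ) : n * genW₁ a b p m ≤ n * D + 2 * C := by
    have hn := genW₁_smul (a := a) hb n p m
    rw [Nat.cast_smul_eq_nsmul, Nat.cast_smul_eq_nsmul] at hn
    calc n * genW₁ a b p m = genW₁ a b (n • p) (n • m) := by rw [hn]; simp
      _ ≤ genW₁ a b (n • p) (n • p + r) +
          (genW₁ a b (n • p + r) (n • m + r) + genW₁ a b (n • m + r) (n • m)) :=
          (genW₁_triangle hb _ _ _).trans (add_le_add le_rfl (genW₁_triangle hb _ _ _))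
      _ ≤ C + (n * D + C) := by
          gcongr
          · simpa using genW₁_add_le (a := a) hb (n • p) (n • p) 0 r
          · exact genW₁_nsmul_add_le hb p m r n
          · rw [genW₁_comm hb]
            simpa using genW₁_add_le (a := a) hb (n • m) (n • m) 0 r
      _ = _ := by ring
  rw [← ENNReal.toReal_le_toReal hW hD]
  by_contra! hlt
  obtain ⟨n, hn⟩ := exists_nat_gt (2 * C.toReal / ((genW₁ a b p m).toReal - D.toReal))
  rw [div_lt_iff₀ (by linarith)] at hn
  have hnD : n * D ≠ ∞ := ENNReal.mul_ne_top (ENNReal.natCast_ne_top n) hD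
  have h2C : 2 * C ≠ ∞ := ENNReal.mul_ne_top ENNReal.ofNat_ne_top hC
  have := ENNReal.toReal_mono (ENNReal.add_ne_top.2 ⟨hnD, h2C⟩) (key n)
  rw [ENNReal.toReal_add hnD h2C] at this
  simp only [ENNReal.toReal_mul, ENNReal.toReal_natCast, ENNReal.toReal_ofNat] at this
  linarith

/-- Adding `m'` to both entries of `(p, m)`, or `m` to both entries of `(p', m')`, yields the same
pair. -/
lemma genW₁_eq_of_diff_eq (hb : 0 < b) {p m p' m' : PosMeas d} (h : diff p m = diff p' m') :
    genW₁ a b p m = genW₁ a b p' m' := by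
  rw [diff_eq_diff_iff] at h
  rw [← genW₁_add_right hb p m m', h, add_comm m m', genW₁_add_right hb]

/-- Plans of arbitrarily small cost give equal integrals of Lipschitz functions with values in `[0,
1]`. Thickened indicators are such functions and converge to indicators of closed sets, which form a
π-system generating the Borel σ-algebra. -/
lemma eq_of_genW₁_eq_zero (ha : 0 < a) (hb : 0 < b) {p m : PosMeas d} (h : genW₁ a b p m = 0) :
    p = m := by
  have key (p m : PosMeas d) (h : genW₁ a b p m = 0) {K : ℝ≥0} {f : Space d → ℝ≥0}
      (hf : LipschitzWith K f) (hf1 : ∀ x, f x ≤ 1) :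
      ∫⁻ x, f x ∂(p : Measure (Space d)) ≤ ∫⁻ x, f x ∂(m : Measure (Space d)) := by
    set C := (ENNReal.ofReal a)⁻¹ + K * (ENNReal.ofReal b)⁻¹
    have hC : C ≠ ∞ := by
      have : ENNReal.ofReal a ≠ 0 := by simpa using ha
      have : ENNReal.ofReal b ≠ 0 := by simpa using hb
      finiteness
    refine ENNReal.le_of_forall_pos_le_add fun ε hε _ => ?_
    obtain ⟨P, hP⟩ := exists_cost_lt a b hb (c := ε / C)
      (by rw [h]; exact ENNReal.div_pos (by simpa using hε.ne') hC)
    refine (P.lintegral_le ha hb hf hf1).trans ?_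
    gcongr
    exact (mul_le_mul_right hP.le C).trans (ENNReal.mul_div_le)
  have hclosed (F : Set (Space d)) (hF : IsClosed F) :
      (p : Measure (Space d)) F = (m : Measure (Space d)) F := by
    have hpos (n : ℕ) : (0 : ℝ) < 1 / ((n : ℝ) + 1) := by positivity
    have hlim := tendsto_one_div_add_atTop_nhds_zero_nat (𝕜 := ℝ)
    refine tendsto_nhds_unique
      (tendsto_lintegral_thickenedIndicator_of_isClosed _ hF hpos hlim) ?_
    refine (tendsto_lintegral_thickenedIndicator_of_isClosed _ hF hpos hlim).congr fun n => ?_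
    have hl := lipschitzWith_thickenedIndicator (hpos n) F
    have hl1 := thickenedIndicator_le_one (hpos n) F
    exact le_antisymm (key m p (by rw [genW₁_comm hb, h]) hl hl1) (key p m h hl hl1)
  have heq : (p : Measure (Space d)) = m :=
    ext_of_generate_finite _
      (by rw [BorelSpace.measurable_eq (α := Space d), borel_eq_generateFrom_isClosed])
      isPiSystem_isClosed hclosed (hclosed _ isClosed_univ)
  exact Subtype.ext heq

end GenW₁

/-! ### The norm on signed measures. -/

section Norm

variable {a b : ℝ}

/-- Since `ENNReal.ofReal` never takes the value `∞`, this identity contains finiteness as well as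
independence of the decomposition. -/
lemma genW₁_eq_ofReal_sgnNorm (hb : 0 < b) (p m : PosMeas d) :
    genW₁ a b p m = ENNReal.ofReal (sgnNorm a b (diff p m)) := by
  rw [sgnNorm, ENNReal.ofReal_toReal (genW₁_ne_top _ _)]
  exact genW₁_eq_of_diff_eq hb (diff_posPart_negPart _).symm

lemma sgnNorm_diff (hb : 0 < b) (p m : PosMeas d) :
    sgnNorm a b (diff p m) = (genW₁ a b p m).toReal := by
  rw [sgnNorm, genW₁_eq_of_diff_eq hb (diff_posPart_negPart (diff p m))]

lemma diff_add_diff (p m p' m' : PosMeas d) :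
    diff p m + diff p' m' = diff (p + p') (m + m') := by
  simp only [diff, FiniteMeasure.toMeasure_add, Measure.toSignedMeasure_add]
  abel

lemma neg_diff (p m : PosMeas d) : -diff p m = diff m p := neg_sub _ _

lemma smul_diff (c : ℝ≥0) (p m : PosMeas d) : (c : ℝ) • diff p m = diff (c • p) (c • m) := by
  simp only [diff, FiniteMeasure.toMeasure_smul, Measure.toSignedMeasure_smul, smul_sub]
  rfl

lemma sgnNorm_nnreal_smul (hb : 0 < b) (c : ℝ≥0) (μ : SgnMeas d) :
    sgnNorm a b ((c : ℝ) • μ) = c * sgnNorm a b μ := by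
  rw [← diff_posPart_negPart μ, smul_diff, sgnNorm_diff hb, sgnNorm_diff hb, genW₁_smul hb]
  simp

lemma sgnNorm_neg (hb : 0 < b) (μ : SgnMeas d) : sgnNorm a b (-μ) = sgnNorm a b μ := by
  rw [← diff_posPart_negPart μ, neg_diff, sgnNorm_diff hb, sgnNorm_diff hb, genW₁_comm hb]

lemma sgnNorm_smul (hb : 0 < b) (c : ℝ) (μ : SgnMeas d) :
    sgnNorm a b (c • μ) = |c| * sgnNorm a b μ := by
  rcases le_total 0 c with hc | hc
  · rw [abs_of_nonneg hc]
    exact sgnNorm_nnreal_smul hb ⟨c, hc⟩ μ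
  · rw [abs_of_nonpos hc, ← sgnNorm_neg hb (c • μ), ← neg_smul c μ]
    exact sgnNorm_nnreal_smul hb ⟨-c, neg_nonneg.2 hc⟩ μ

lemma sgnNorm_add_le (hb : 0 < b) (μ η : SgnMeas d) :
    sgnNorm a b (μ + η) ≤ sgnNorm a b μ + sgnNorm a b η := by
  rw [← diff_posPart_negPart μ, ← diff_posPart_negPart η, diff_add_diff, sgnNorm_diff hb,
    sgnNorm_diff hb, sgnNorm_diff hb, ← ENNReal.toReal_add (genW₁_ne_top _ _) (genW₁_ne_top _ _)]
  exact ENNReal.toReal_mono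
    (ENNReal.add_ne_top.2 ⟨genW₁_ne_top _ _, genW₁_ne_top _ _⟩) (genW₁_add_le hb _ _ _ _)

lemma sgnNorm_eq_zero_iff (ha : 0 < a) (hb : 0 < b) (μ : SgnMeas d) :
    sgnNorm a b μ = 0 ↔ μ = 0 := by
  constructor
  · intro h
    have h' := (ENNReal.toReal_eq_zero_iff _).1 h
    have h0 := eq_of_genW₁_eq_zero ha hb (h'.resolve_right (genW₁_ne_top _ _))
    rw [← diff_posPart_negPart μ, h0]
    exact sub_self _
  · rintro rfl
    simpa using sgnNorm_smul (a := a) hb 0 (0 : SgnMeas d)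

end Norm

end GenWasserstein

end

/-- For `a, b > 0`, the quantity `‖μ‖^{a,b}` is well defined: it is finite and any decomposition
`μ = p - m` into positive finite measures gives the same value. Together with the vector space
structure of `𝓜^s(ℝ^d)` it is a norm: it is nonnegative, homogeneous, satisfies the triangle
inequality, and vanishes exactly at `0`. -/
theorem proposition20 (d : ℕ) (a b : ℝ) (ha : 0 < a) (hb : 0 < b) :
    (∀ (μ : GenWasserstein.SgnMeas d) (p m : GenWasserstein.PosMeas d),
      μ = GenWasserstein.diff p m →
        GenWasserstein.genW₁ a b p m = ENNReal.ofReal (GenWasserstein.sgnNorm a b μ)) ∧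
    @NormedSpace.Core ℝ (GenWasserstein.SgnMeas d) _ _ _ ⟨GenWasserstein.sgnNorm a b⟩ := by
  refine ⟨fun μ p m h => h ▸ GenWasserstein.genW₁_eq_ofReal_sgnNorm hb p m, ?_⟩
  let _ : Norm (GenWasserstein.SgnMeas d) := ⟨GenWasserstein.sgnNorm a b⟩
  exact
    { norm_nonneg := fun _ => ENNReal.toReal_nonneg
      norm_smul := fun c μ => GenWasserstein.sgnNorm_smul hb c μ
      norm_triangle := GenWasserstein.sgnNorm_add_le hb
      norm_eq_zero_iff := GenWasserstein.sgnNorm_eq_zero_iff ha hb }
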